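/- For $\tau$ in the upper half plane $\mathbb{H}^2=\{\tau\in\mathbb{C} : \operatorname{Im}\tau>0\}$ put $q=\exp(2\pi i\tau)$ and let $\eta(\tau)=e^{2\pi i\tau/24}\prod_{n=1}^{\infty}(1-q^n)$ be the Dedekind eta function. Let $\left(\frac{n}{3}\right)$ be the Legendre symbol modulo $3$ (equal to $1,-1,0$ according as $n\equiv 1,-1,0 \pmod 3$), and for positive integers $j,k,n$ let $d_{j,k}(n)$ be the number of positive divisors $d$ of $n$ with $d\equiv j\pmod k$. Then for every $\tau\in\mathbb{H}^2$, both series below converge absolutely and $$\frac{\eta^5(2\tau)}{\eta^2(\tau)}=\sum_{n=1}^{\infty}(-1)^{n-1}\,n\left(\frac{n}{3}\right)\exp\left(\frac{2\pi i n^2\tau}{3}\right)$$ (the Köhler–Macdonald identity), and $$\frac{\eta^6(2\tau)\,\eta(3\tau)}{\eta^3(\tau)\,\eta^2(6\tau)}=1+3\sum_{n=1}^{\infty}\bigl(d_{1,6}(n)-d_{5,6}(n)\bigr)q^n .$$ -/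

import Mathlib

/-- `d_{j,k}(n)`: the number of positive divisors `d` of `n` with `d ≡ j (mod k)`. -/
def divisorCountMod (j k n : ℕ) : ℕ :=
  (n.divisors.filter fun d => d ≡ j [MOD k]).card

open Complex Filter Topology

/-! Write `e_k` for `qProd (q ^ k) (q ^ k)`. Both identities rest on the Jacobi triple product,
which turns values of `jacobiTheta₂`, and its derivative at a zero, into products of the `e_k`.

Köhler–Macdonald: weight the double series of `q ^ (i ^ 2) * (-1) ^ m * q ^ (2 * m ^ 2 + 2 * m)` by
`n = i + 2 * m + 1`. Summed as a product it equals `2 * e_4 ^ 3` times `∑ q ^ (i ^ 2)`, because `∑ i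
* q ^ (i ^ 2)` and the unweighted sum over `m` vanish (`hasSum_thetaProductTerm`). Summed along
fixed `n`, the inner sum satisfies a first-order recurrence in steps of three, with values `0, e_4,
q * e_4` at `n = 0, 1, 2`; this produces the Legendre symbol (`mul_tsum_thetaProductTerm`). Gauss's
product for `∑ q ^ (i ^ 2)` finishes.

Weight one: let `Θ` be the theta function moved to its zero and differentiate `exp (2πix) Θ(1/6 + x)
Θ(1/3 + x)` at `x = 0`. By the addition formula it is a theta function vanishing at `0` plus a
function even in `x`, so its derivative is a product of `e_2 ^ 3` and `jacobiTheta₂ (1 / 6) (2 *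
τ)`. Logarithmically, the same derivative is a Lambert series at sixth roots of unity, which
collapses to the odd character modulo `6`. -/

/-- The infinite product `(x; q)_∞ = ∏_{n ≥ 0} (1 - x q ^ n)`. -/
noncomputable def qProd (x q : ℂ) : ℂ := ∏' n : ℕ, (1 - x * q ^ n)

/-! ### Convergence, factorisations and logarithmic derivative of q-products. -/

lemma summable_norm_mul_pow (x : ℂ) {q : ℂ} (hq : ‖q‖ < 1) :
    Summable fun n : ℕ ↦ ‖-(x * q ^ n)‖ := by
  simpa using (summable_geometric_of_lt_one (norm_nonneg _) hq).mul_left ‖x‖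

lemma multipliable_qProd (x : ℂ) {q : ℂ} (hq : ‖q‖ < 1) :
    Multipliable fun n : ℕ ↦ 1 - x * q ^ n :=
  multipliable_one_add_of_summable (f := fun n ↦ -(x * q ^ n)) (summable_norm_mul_pow x hq)

lemma qProd_ne_zero {x q : ℂ} (hq : ‖q‖ < 1) (h : ∀ n : ℕ, 1 - x * q ^ n ≠ 0) : qProd x q ≠ 0 :=
  tprod_one_add_ne_zero_of_summable (f := fun n ↦ -(x * q ^ n)) h (summable_norm_mul_pow x hq)

lemma one_sub_mul_pow_ne_zero {x q : ℂ} (hq : ‖q‖ < 1) (hx : ‖x‖ < 1) (n : ℕ) :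
    1 - x * q ^ n ≠ 0 := by
  intro h
  have h1 : ‖x * q ^ n‖ = 1 := by rw [← sub_eq_zero.mp h]; simp
  have h2 : ‖q‖ ^ n ≤ 1 := pow_le_one₀ (norm_nonneg _) hq.le
  rw [norm_mul, norm_pow] at h1
  nlinarith [norm_nonneg x, norm_nonneg q]

lemma qProd_ne_zero_of_norm_lt_one {x q : ℂ} (hq : ‖q‖ < 1) (hx : ‖x‖ < 1) : qProd x q ≠ 0 :=
  qProd_ne_zero hq (one_sub_mul_pow_ne_zero hq hx)

lemma qProd_eq_one_sub_mul (x : ℂ) {q : ℂ} (hq : ‖q‖ < 1) :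
    qProd x q = (1 - x) * qProd (x * q) q := by
  rw [qProd, tprod_eq_zero_mul', qProd]
  · simp [pow_succ', mul_assoc]
  · simpa [pow_succ', mul_assoc] using multipliable_qProd (x * q) hq

lemma qProd_mul_qProd_neg (x : ℂ) {q : ℂ} (hq : ‖q‖ < 1) :
    qProd x q * qProd (-x) q = qProd (x ^ 2) (q ^ 2) := by
  rw [qProd, qProd, ← (multipliable_qProd x hq).tprod_mul (multipliable_qProd (-x) hq), qProd]
  refine tprod_congr fun n ↦ ?_
  ring

lemma qProd_mul_qProd_mul_qProd {ω : ℂ} (hω : ω ^ 2 + ω + 1 = 0) (x : ℂ) {q : ℂ} (hq : ‖q‖ < 1) :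
    qProd x q * (qProd (ω * x) q * qProd (ω ^ 2 * x) q) = qProd (x ^ 3) (q ^ 3) := by
  rw [qProd, qProd, qProd, ← (multipliable_qProd _ hq).tprod_mul (multipliable_qProd _ hq),
    ← (multipliable_qProd _ hq).tprod_mul
      ((multipliable_qProd _ hq).mul (multipliable_qProd _ hq)), qProd]
  refine tprod_congr fun n ↦ ?_
  rw [← pow_mul, mul_comm 3 n, pow_mul]
  generalize q ^ n = r
  have h3 : ω ^ 3 = 1 := by linear_combination (ω - 1) * hω
  linear_combination (-(x * r) + ω * (x * r) ^ 2 ) * hω - (x * r) ^ 3 * h3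

lemma norm_pow_lt_one {q : ℂ} (hq : ‖q‖ < 1) {k : ℕ} (hk : k ≠ 0) : ‖q ^ k‖ < 1 := by
  rw [norm_pow]; exact pow_lt_one₀ (norm_nonneg _) hq hk

lemma qProd_even_mul_odd (x : ℂ) {q : ℂ} (hq : ‖q‖ < 1) :
    qProd x (q ^ 2) * qProd (x * q) (q ^ 2) = qProd x q := by
  have h2 := norm_pow_lt_one hq two_ne_zero
  have := tprod_even_mul_odd (f := fun n : ℕ ↦ 1 - x * q ^ n)
    (by simpa [pow_mul] using multipliable_qProd x h2)
    (by simpa [pow_mul, pow_succ', mul_assoc] using multipliable_qProd (x * q) h2)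
  simpa [qProd, pow_mul, pow_succ', mul_assoc] using this

lemma qProd_mod_three (x : ℂ) {q : ℂ} (hq : ‖q‖ < 1) :
    qProd x (q ^ 3) * (qProd (x * q) (q ^ 3) * qProd (x * q ^ 2) (q ^ 3)) = qProd x q := by
  have h3 := norm_pow_lt_one hq three_ne_zero
  rw [qProd, qProd, qProd, ← (multipliable_qProd _ h3).tprod_mul (multipliable_qProd _ h3),
    ← (multipliable_qProd _ h3).tprod_mul
      ((multipliable_qProd _ h3).mul (multipliable_qProd _ h3)), qProd]
  have hL := ((multipliable_qProd x h3).mul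
      ((multipliable_qProd (x * q) h3).mul (multipliable_qProd (x * q ^ 2) h3)))
  have hR := (multipliable_qProd x hq).tendsto_prod_tprod_nat
  have hR' := hR.comp (tendsto_id.const_mul_atTop' (r := 3) (by norm_num))
  -- The first `n` factors of each product on the left are together the first `3 * n` factors on the
  -- right.
  refine tendsto_nhds_unique hL.tendsto_prod_tprod_nat (hR'.congr fun n ↦ ?_)
  simp only [Function.comp, id]
  induction n with
  | zero => simp
  | succ n ih =>
    rw [Finset.prod_range_succ, ← ih, mul_add, mul_one, Finset.prod_range_succ,
      Finset.prod_range_succ, Finset.prod_range_succ]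
    ring

lemma differentiable_qProd {q : ℂ} (hq : ‖q‖ < 1) : Differentiable ℂ (qProd · q) ∧
    ∀ x, (∀ n : ℕ, 1 - x * q ^ n ≠ 0) →
      logDeriv (qProd · q) x = ∑' n : ℕ, -(q ^ n / (1 - x * q ^ n)) := by
  have key : ∀ R : ℝ, MultipliableLocallyUniformlyOn (fun (n : ℕ) (x : ℂ) ↦ 1 - x * q ^ n)
      (Metric.ball 0 R) := by
    intro R
    simp_rw [sub_eq_add_neg]
    refine Summable.multipliableLocallyUniformlyOn_nat_one_add (u := fun n ↦ R * ‖q‖ ^ n)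
      Metric.isOpen_ball ((summable_geometric_of_lt_one (norm_nonneg _) hq).mul_left R)
      (Eventually.of_forall fun n x hx ↦ ?_) (fun n ↦ by fun_prop)
    rw [norm_neg, norm_mul, norm_pow]
    gcongr
    simpa using (Metric.mem_ball.mp hx).le
  refine ⟨fun x ↦ ?_, fun x hx ↦ ?_⟩
  · have : DifferentiableOn ℂ (qProd · q) (Metric.ball 0 (‖x‖ + 1)) :=
      (key (‖x‖ + 1)).hasProdLocallyUniformlyOn.differentiableOn
        (.of_forall fun _ ↦ by simpa [Finset.prod_fn] using
          DifferentiableOn.finsetProd (fun _ _ ↦ by fun_prop)) Metric.isOpen_ball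
    exact this.differentiableAt (Metric.isOpen_ball.mem_nhds (by simp))
  · have hl : ∀ n : ℕ, logDeriv (fun x : ℂ ↦ 1 - x * q ^ n) x = -(q ^ n / (1 - x * q ^ n)) := by
      intro n
      have : HasDerivAt (fun x : ℂ ↦ 1 - x * q ^ n) (-(1 * q ^ n)) x :=
        ((hasDerivAt_id x).mul_const (q ^ n)).const_sub 1
      rw [logDeriv_apply, this.deriv]
      ring
    -- The inverses converge, hence are bounded; the series is then dominated by a geometric one.
    have ht : Tendsto (fun n : ℕ ↦ ‖(1 - x * q ^ n)⁻¹‖) atTop (𝓝 ‖(1 - x * 0)⁻¹‖) :=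
      (((tendsto_pow_atTop_nhds_zero_of_norm_lt_one hq).const_mul x).const_sub 1
        |>.inv₀ (by simp)).norm
    obtain ⟨C, hC⟩ := ht.bddAbove_range
    have hs : Summable fun n : ℕ ↦ logDeriv (fun x : ℂ ↦ 1 - x * q ^ n) x := by
      refine Summable.of_norm_bounded
        ((summable_geometric_of_lt_one (norm_nonneg _) hq).mul_left C) fun n ↦ ?_
      rw [hl, norm_neg, div_eq_inv_mul, norm_mul, norm_pow]
      gcongr
      exact hC ⟨n, rfl⟩
    have := logDeriv_tprod_eq_tsum (f := fun (n : ℕ) (x : ℂ) ↦ 1 - x * q ^ n)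
      (Metric.isOpen_ball (x := 0) (ε := ‖x‖ + 1)) (x := x) (by simp) hx
      (fun n ↦ by fun_prop) hs (key _) (qProd_ne_zero hq hx)
    simp_rw [hl] at this
    exact this

/-! ### The Jacobi triple product. -/

/-- The finite product `(q; q)_n`. -/
noncomputable def qFactorial (q : ℂ) (n : ℕ) : ℂ := ∏ k ∈ Finset.range n, (1 - q * q ^ k)

/-- The reciprocal of `(q; q)_m`, extended by zero to negative integers `m`. -/
noncomputable def qFactorialInv (q : ℂ) (m : ℤ) : ℂ :=
  if 0 ≤ m then (qFactorial q m.toNat)⁻¹ else 0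

/-- Extension by zero makes the recurrence hold for every integer: at `m = 0` the factor `1 - q ^ 0`
vanishes. -/
lemma qFactorialInv_sub_one {q : ℂ} (hq : ‖q‖ < 1) (m : ℤ) :
    qFactorialInv q (m - 1) = (1 - q ^ m) * qFactorialInv q m := by
  rcases lt_trichotomy m 0 with h | rfl | h
  · rw [qFactorialInv, qFactorialInv, if_neg (by omega), if_neg (by omega), mul_zero]
  · simp [qFactorialInv]
  · obtain ⟨n, rfl⟩ : ∃ n : ℕ, m = n + 1 := ⟨(m - 1).toNat, by omega⟩
    have h0 := one_sub_mul_pow_ne_zero hq hq n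
    simp only [qFactorialInv, add_sub_cancel_right, Int.natCast_nonneg, if_true,
      show (0 : ℤ) ≤ n + 1 by omega, Int.toNat_natCast, show ((n : ℤ) + 1).toNat = n + 1 by omega]
    rw [qFactorial, qFactorial, Finset.prod_range_succ, mul_inv,
      show q ^ ((n : ℤ) + 1) = q * q ^ n by
        rw [← pow_succ', ← zpow_natCast]; push_cast; rfl]
    field_simp

/-- Finite form of the triple product, with Gaussian binomials as coefficients; the zero convention
lets `j` range over all of `ℤ`. -/
lemma hasSum_finite_jacobi_triple {p u : ℂ} (hp : ‖p‖ < 1) (hp0 : p ≠ 0) (hu : u ≠ 0) (n : ℕ) :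
    HasSum (fun j : ℤ ↦ qFactorial (p ^ 2) (2 * n) * (qFactorialInv (p ^ 2) (n - j) *
        qFactorialInv (p ^ 2) (n + j)) * (p ^ (j ^ 2) * u ^ j))
      (∏ k ∈ Finset.range n, ((1 - -(p * u) * (p ^ 2) ^ k) * (1 - -(p / u) * (p ^ 2) ^ k))) := by
  have hq := norm_pow_lt_one hp two_ne_zero
  induction n with
  | zero =>
    simp only [Finset.range_zero, Finset.prod_empty]
    convert hasSum_single (0 : ℤ) fun j hj ↦ ?_ using 1
    · simp [qFactorial, qFactorialInv]
    · rcases lt_or_gt_of_ne hj with h | h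
      · rw [qFactorialInv, qFactorialInv, if_neg (show ¬ 0 ≤ ((0 : ℕ) : ℤ) + j by simpa using h)]
        simp
      · rw [qFactorialInv, if_neg (show ¬ 0 ≤ ((0 : ℕ) : ℤ) - j by simpa using h)]
        simp
  | succ n ih =>
    have h1 := (Equiv.addRight (-1 : ℤ)).hasSum_iff.mpr ih
    have h2 := (Equiv.addRight (1 : ℤ)).hasSum_iff.mpr ih
    -- The factor with `k = n` expands to `1 + p ^ (4n+2) + p ^ (2n+1) * u + p ^ (2n+1) / u`; its
    -- last two terms shift `j` by one.
    have h := ((ih.mul_left (1 + p ^ (4 * n + 2))).add (h1.mul_left (p ^ (2 * n + 1) * u))).add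
      (h2.mul_left (p ^ (2 * n + 1) / u))
    have hprod : (∏ k ∈ Finset.range (n + 1),
        ((1 - -(p * u) * (p ^ 2) ^ k) * (1 - -(p / u) * (p ^ 2) ^ k))) =
        (1 + p ^ (4 * n + 2) + p ^ (2 * n + 1) * u + p ^ (2 * n + 1) / u) *
        (∏ k ∈ Finset.range n,
          ((1 - -(p * u) * (p ^ 2) ^ k) * (1 - -(p / u) * (p ^ 2) ^ k))) := by
      rw [Finset.prod_range_succ, mul_comm]
      congr 1
      field_simp
      ring
    rw [hprod, add_mul, add_mul]
    refine Eq.subst (motive := fun f ↦ HasSum f _) (funext fun j ↦ ?_) h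
    simp only [Function.comp, Equiv.coe_addRight]
    have hq0 : p ^ 2 ≠ 0 := pow_ne_zero 2 hp0
    have e1 := qFactorialInv_sub_one hq (n + 1 - j)
    have e2 := qFactorialInv_sub_one hq (n + 1 + j)
    have e3 := qFactorialInv_sub_one hq (n - j)
    have e4 := qFactorialInv_sub_one hq (n + j)
    have hA : (p ^ 2) ^ ((n : ℤ) + 1 - j) = p ^ 2 * (p ^ 2) ^ ((n : ℤ) - j) := by
      rw [← zpow_one_add₀ hq0]; congr 1; ring
    have hB : (p ^ 2) ^ ((n : ℤ) + 1 + j) = p ^ 2 * (p ^ 2) ^ ((n : ℤ) + j) := by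
      rw [← zpow_one_add₀ hq0]; congr 1; ring
    have hab : (p ^ 2) ^ (2 * n) = (p ^ 2) ^ ((n : ℤ) - j) * (p ^ 2) ^ ((n : ℤ) + j) := by
      rw [← zpow_add₀ hq0, ← zpow_natCast]; congr 1; push_cast; ring
    have hq2 (m : ℤ) : (p ^ 2) ^ m = p ^ (2 * m) := by
      rw [zpow_mul]; norm_cast
    have hT1 : p ^ (2 * n + 1) * p ^ ((j + -1) ^ 2) =
        p ^ 2 * (p ^ 2) ^ ((n : ℤ) - j) * p ^ (j ^ 2) := by
      rw [← hA, hq2, ← zpow_natCast, ← zpow_add₀ hp0, ← zpow_add₀ hp0]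
      congr 1; push_cast; ring
    have hT2 : p ^ (2 * n + 1) * p ^ ((j + 1) ^ 2) =
        p ^ 2 * (p ^ 2) ^ ((n : ℤ) + j) * p ^ (j ^ 2) := by
      rw [← hB, hq2, ← zpow_natCast, ← zpow_add₀ hp0, ← zpow_add₀ hp0]
      congr 1; push_cast; ring
    have hU1 : u * u ^ (j + -1) = u ^ j := by
      rw [← zpow_one_add₀ hu]; congr 1; ring
    have hU2 : u ^ (j + 1) / u = u ^ j := by
      rw [zpow_add_one₀ hu]; field_simp
    rw [show (n : ℤ) + 1 - j - 1 = n - j by ring, hA] at e1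
    rw [show (n : ℤ) + 1 + j - 1 = n + j by ring, hB] at e2
    rw [e1] at e3
    rw [e2] at e4
    push_cast
    rw [show (n : ℤ) - (j + -1) = n + 1 - j by ring, show (n : ℤ) - (j + 1) = n - j - 1 by ring,
      show (n : ℤ) + (j + -1) = n + j - 1 by ring, show (n : ℤ) + (j + 1) = n + 1 + j by ring,
      e1, e2, e3, e4, show 2 * (n + 1) = 2 * n + 1 + 1 by ring, qFactorial, qFactorial,
      Finset.prod_range_succ, Finset.prod_range_succ, ← qFactorial, pow_succ (p ^ 2) (2 * n), hab,
      show p ^ (4 * n + 2) = p ^ 2 * (p ^ 2) ^ (2 * n) by ring, hab]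
    generalize (p ^ 2) ^ ((n : ℤ) - j) = a at *
    generalize (p ^ 2) ^ ((n : ℤ) + j) = b at *
    generalize qFactorialInv (p ^ 2) (n + 1 - j) = R at *
    generalize qFactorialInv (p ^ 2) (n + 1 + j) = S at *
    generalize qFactorial (p ^ 2) (2 * n) = F at *
    clear hq2 h h1 h2 ih hprod
    calc _ = (1 + p ^ 2 * (a * b)) * (F * ((1 - p ^ 2 * a) * R * ((1 - p ^ 2 * b) * S)) *
          (p ^ j ^ 2 * u ^ j)) +
          (p ^ (2 * n + 1) * p ^ ((j + -1) ^ 2)) * (u * u ^ (j + -1)) *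
            (F * (R * ((1 - b) * ((1 - p ^ 2 * b) * S)))) +
          (p ^ (2 * n + 1) * p ^ ((j + 1) ^ 2)) * (u ^ (j + 1) / u) *
            (F * ((1 - a) * ((1 - p ^ 2 * a) * R) * S)) := by ring
      _ = _ := by rw [hT1, hT2, hU1, hU2]; ring

lemma tendsto_qFactorial {q : ℂ} (hq : ‖q‖ < 1) :
    Tendsto (qFactorial q) atTop (𝓝 (qProd q q)) :=
  (multipliable_qProd q hq).tendsto_prod_tprod_nat

/-- Let `n` tend to infinity in the finite identity. The coefficients are bounded uniformly and tend
to `1 / qProd Q Q`, so dominated convergence applies. -/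
theorem tsum_jacobi_triple {p u : ℂ} (hp : ‖p‖ < 1) (hp0 : p ≠ 0) (hu : u ≠ 0)
    (hs : Summable fun j : ℤ ↦ p ^ (j ^ 2) * u ^ j) :
    ∑' j : ℤ, p ^ (j ^ 2) * u ^ j =
      qProd (p ^ 2) (p ^ 2) * (qProd (-(p * u)) (p ^ 2) * qProd (-(p / u)) (p ^ 2)) := by
  have hq := norm_pow_lt_one hp two_ne_zero
  set Q := p ^ 2 with hQ
  have hE : qProd Q Q ≠ 0 := qProd_ne_zero_of_norm_lt_one hq hq
  have hF := tendsto_qFactorial hq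
  have hI : Tendsto (qFactorialInv Q) atTop (𝓝 (qProd Q Q)⁻¹) := by
    refine ((hF.inv₀ hE).comp (tendsto_atTop.mpr fun b ↦
      (eventually_ge_atTop (b : ℤ)).mono fun m hm ↦ (by omega : b ≤ m.toNat))).congr' ?_
    filter_upwards [eventually_ge_atTop 0] with m hm
    simp [qFactorialInv, hm]
  obtain ⟨M, hM⟩ := hF.norm.bddAbove_range
  obtain ⟨D, hD⟩ := (hF.inv₀ hE).norm.bddAbove_range
  have hD0 : 0 ≤ D := (norm_nonneg _).trans (hD ⟨0, rfl⟩)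
  have hM0 : 0 ≤ M := (norm_nonneg _).trans (hM ⟨0, rfl⟩)
  have hbI : ∀ m, ‖qFactorialInv Q m‖ ≤ D := by
    intro m
    rw [qFactorialInv]
    split_ifs
    · exact hD ⟨m.toNat, rfl⟩
    · simpa using hD0
  have hlim := tendsto_tsum_of_dominated_convergence (𝓕 := atTop)
    (f := fun (n : ℕ) (j : ℤ) ↦ qFactorial Q (2 * n) * (qFactorialInv Q (n - j) *
        qFactorialInv Q (n + j)) * (p ^ (j ^ 2) * u ^ j))
    (g := fun j ↦ qProd Q Q * ((qProd Q Q)⁻¹ * (qProd Q Q)⁻¹) * (p ^ (j ^ 2) * u ^ j))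
    (hs.norm.mul_left (M * (D * D))) (fun j ↦ ?_) (Eventually.of_forall fun n j ↦ ?_)
  · replace hlim := hlim.congr fun n ↦ (hasSum_finite_jacobi_triple hp hp0 hu n).tsum_eq
    have hP := ((multipliable_qProd (-(p * u)) hq).mul
      (multipliable_qProd (-(p / u)) hq)).tendsto_prod_tprod_nat
    rw [(multipliable_qProd _ hq).tprod_mul (multipliable_qProd _ hq)] at hP
    have := tendsto_nhds_unique hlim hP
    rw [tsum_mul_left] at this
    rw [qProd.eq_1 (-(p * u)), qProd.eq_1 (-(p / u)), ← this]
    field_simp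
  · refine ((hF.comp (tendsto_id.const_mul_atTop' (r := 2) (by norm_num))).mul
      ((hI.comp ?_).mul (hI.comp ?_))).mul_const _
    · exact tendsto_atTop_add_const_right _ (-j) tendsto_natCast_atTop_atTop
    · exact tendsto_atTop_add_const_right _ j tendsto_natCast_atTop_atTop
  · rw [norm_mul, norm_mul, norm_mul]
    gcongr
    · exact hM ⟨2 * n, rfl⟩
    · exact hbI _
    · exact hbI _

/-! ### Theta and eta functions as products. -/

lemma norm_exp_pi_mul_I_lt_one {τ : ℂ} (hτ : 0 < τ.im) : ‖exp (Real.pi * I * τ)‖ < 1 := by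
  rw [Complex.norm_exp, Real.exp_lt_one_iff]
  simpa using mul_pos Real.pi_pos hτ

lemma jacobiTheta₂_term_eq_zpow (n : ℤ) (z τ : ℂ) :
    jacobiTheta₂_term n z τ = exp (Real.pi * I * τ) ^ (n ^ 2) * exp (2 * Real.pi * I * z) ^ n := by
  rw [jacobiTheta₂_term, ← Complex.exp_int_mul, ← Complex.exp_int_mul, ← Complex.exp_add]
  congr 1
  push_cast
  ring

/-- The Jacobi triple product identity. -/
theorem jacobiTheta₂_eq_qProd (z : ℂ) {τ : ℂ} (hτ : 0 < τ.im) {p u : ℂ}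
    (hp : p = exp (Real.pi * I * τ)) (hu : u = exp (2 * Real.pi * I * z)) :
    jacobiTheta₂ z τ =
      qProd (p ^ 2) (p ^ 2) * (qProd (-(p * u)) (p ^ 2) * qProd (-(p / u)) (p ^ 2)) := by
  have hs := (summable_jacobiTheta₂_term_iff z τ).mpr hτ
  simp only [jacobiTheta₂, jacobiTheta₂_term_eq_zpow, ← hp, ← hu] at hs ⊢
  exact tsum_jacobi_triple (hp ▸ norm_exp_pi_mul_I_lt_one hτ) (hp ▸ exp_ne_zero _)
    (hu ▸ exp_ne_zero _) hs

/-- The theta function with its argument moved by the zero `(1 + τ) / 2`. -/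
lemma jacobiTheta₂_add_half_period (z : ℂ) {τ : ℂ} (hτ : 0 < τ.im) {q x : ℂ}
    (hq : q = exp (2 * Real.pi * I * τ)) (hx : x = exp (2 * Real.pi * I * z)) :
    jacobiTheta₂ (z + τ / 2 + 1 / 2) τ = qProd q q * (qProd (q * x) q * qProd x⁻¹ q) := by
  have hp2 : exp (Real.pi * I * τ) ^ 2 = q := by
    rw [hq, ← Complex.exp_nat_mul]; congr 1; push_cast; ring
  have hu : exp (2 * Real.pi * I * (z + τ / 2 + 1 / 2)) = - (exp (Real.pi * I * τ) * x) := by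
    rw [show 2 * Real.pi * I * (z + τ / 2 + 1 / 2) =
      Real.pi * I * τ + 2 * Real.pi * I * z + Real.pi * I by ring, exp_add, exp_add, exp_pi_mul_I,
      ← hx]
    ring
  have hp0 := exp_ne_zero (Real.pi * I * τ)
  have hx0 : x ≠ 0 := hx ▸ exp_ne_zero _
  rw [jacobiTheta₂_eq_qProd _ hτ rfl rfl, hu, hp2]
  congr 3
  · rw [← hp2]; ring
  · field_simp

lemma norm_exp_two_pi_mul_I_lt_one {τ : ℂ} (hτ : 0 < τ.im) : ‖exp (2 * Real.pi * I * τ)‖ < 1 := by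
  rw [show 2 * Real.pi * I * τ = Real.pi * I * (2 * τ) by ring]
  exact norm_exp_pi_mul_I_lt_one (by simpa using hτ)

lemma jacobiTheta₂_half_period {τ : ℂ} (hτ : 0 < τ.im) :
    jacobiTheta₂ (τ / 2 + 1 / 2) τ = 0 := by
  have := jacobiTheta₂_add_half_period 0 hτ rfl rfl
  have h0 : qProd 1 (exp (2 * Real.pi * I * τ)) = 0 := by
    rw [qProd_eq_one_sub_mul _ (norm_exp_two_pi_mul_I_lt_one hτ)]; simp
  simpa [h0] using this

/-- Jacobi's formula for the cube of the Euler product: the zero comes from the factor `1 - x⁻¹`, so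
the derivative is that of this factor times the other factors at `x = 1`. -/
lemma jacobiTheta₂'_half_period {τ : ℂ} (hτ : 0 < τ.im) {q : ℂ}
    (hq : q = exp (2 * Real.pi * I * τ)) :
    jacobiTheta₂' (τ / 2 + 1 / 2) τ = 2 * Real.pi * I * qProd q q ^ 3 := by
  have hq1 : ‖q‖ < 1 := hq ▸ norm_exp_two_pi_mul_I_lt_one hτ
  have hd := (differentiable_qProd hq1).1
  have hx : HasDerivAt (fun z : ℂ ↦ exp (2 * Real.pi * I * z)) (2 * Real.pi * I) 0 := by
    simpa using ((hasDerivAt_id (0 : ℂ)).const_mul (2 * Real.pi * I)).cexp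
  have hxi : HasDerivAt (fun z : ℂ ↦ (exp (2 * Real.pi * I * z))⁻¹) (-(2 * Real.pi * I)) 0 := by
    simpa using! hx.inv (by simp)
  have hR : DifferentiableAt ℂ (fun z : ℂ ↦ qProd q q * (qProd (q * exp (2 * Real.pi * I * z)) q *
      qProd ((exp (2 * Real.pi * I * z))⁻¹ * q) q)) 0 := by
    refine (DifferentiableAt.mul ?_ ?_).const_mul _
    · exact (hd _).comp (0 : ℂ) (hx.differentiableAt.const_mul q)
    · exact (hd _).comp (0 : ℂ) (hxi.differentiableAt.mul_const q)
  have h1 := (hxi.const_sub 1).mul hR.hasDerivAt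
  have h2 : HasDerivAt (fun z ↦ jacobiTheta₂ (z + (τ / 2 + 1 / 2)) τ)
      (jacobiTheta₂' (τ / 2 + 1 / 2) τ) 0 :=
    HasDerivAt.comp_add_const 0 (τ / 2 + 1 / 2)
      (by rw [zero_add]; exact hasDerivAt_jacobiTheta₂_fst (τ / 2 + 1 / 2) hτ)
  have h3 := h2.unique (h1.congr_of_eventuallyEq (Eventually.of_forall fun z ↦ ?_))
  · rw [h3]; simp; ring
  · simp only [Pi.mul_apply]
    rw [← add_assoc, jacobiTheta₂_add_half_period z hτ hq rfl,
      qProd_eq_one_sub_mul (exp (2 * Real.pi * I * z))⁻¹ hq1]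
    ring

lemma eta_eq_exp_mul_qProd (z : ℂ) : ModularForm.eta z =
    exp (2 * Real.pi * I * z / 24) * qProd (exp (2 * Real.pi * I * z))
      (exp (2 * Real.pi * I * z)) := by
  rw [ModularForm.eta, qProd]
  simp [Function.Periodic.qParam, pow_succ']

/-! ### Values of the infinite products -/

lemma qProd_sq_of_norm_lt_one {q : ℂ} (hq : ‖q‖ < 1) :
    qProd q (q ^ 2) * qProd (q ^ 2) (q ^ 2) = qProd q q := by
  simpa [sq] using qProd_even_mul_odd q hq

lemma qProd_neg_mul {q : ℂ} (hq : ‖q‖ < 1) :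
    qProd (-q) (q ^ 2) * (qProd q q * qProd (q ^ 4) (q ^ 4)) = qProd (q ^ 2) (q ^ 2) ^ 2 := by
  have hq2 := norm_pow_lt_one hq two_ne_zero
  have h1 := qProd_sq_of_norm_lt_one hq
  have h2 := qProd_sq_of_norm_lt_one hq2
  have h3 := qProd_mul_qProd_neg q hq2
  rw [← pow_mul] at h2 h3
  norm_num at h2 h3
  rw [← h1]
  linear_combination qProd (q ^ 2) (q ^ 2) * qProd (q ^ 4) (q ^ 4) * h3 +
    qProd (q ^ 2) (q ^ 2) * h2

/-- Gauss's product for `∑ q ^ (n ^ 2)`. -/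
lemma jacobiTheta₂_zero_two_mul {τ : ℂ} (hτ : 0 < τ.im) {q : ℂ}
    (hq : q = exp (2 * Real.pi * I * τ)) :
    jacobiTheta₂ 0 (2 * τ) * (qProd q q ^ 2 * qProd (q ^ 4) (q ^ 4) ^ 2) =
      qProd (q ^ 2) (q ^ 2) ^ 5 := by
  have hq1 : ‖q‖ < 1 := hq ▸ norm_exp_two_pi_mul_I_lt_one hτ
  rw [jacobiTheta₂_eq_qProd (p := q) (u := 1) 0 (by simpa using hτ) (by rw [hq]; congr 1; ring)
    (by simp)]
  have := qProd_neg_mul hq1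
  simp only [mul_one, div_one]
  linear_combination qProd (q ^ 2) (q ^ 2) * (qProd (-q) (q ^ 2) *
    (qProd q q * qProd (q ^ 4) (q ^ 4)) + qProd (q ^ 2) (q ^ 2) ^ 2) * this

/-- Euler's pentagonal number theorem in terms of the theta function. -/
lemma jacobiTheta₂_three_mul {τ : ℂ} (hτ : 0 < τ.im) {q : ℂ}
    (hq : q = exp (2 * Real.pi * I * τ)) :
    jacobiTheta₂ (τ / 2 + 1 / 2) (3 * τ) = qProd q q := by
  have hq1 : ‖q‖ < 1 := hq ▸ norm_exp_two_pi_mul_I_lt_one hτ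
  have h := jacobiTheta₂_add_half_period (-τ) (τ := 3 * τ) (q := q ^ 3) (x := q⁻¹)
    (by simpa using hτ)
    (by rw [hq, ← Complex.exp_nat_mul]; congr 1; push_cast; ring)
    (by rw [hq, ← Complex.exp_neg]; congr 1; ring)
  have hq0 : q ≠ 0 := hq ▸ exp_ne_zero _
  rw [show -τ + 3 * τ / 2 + 1 / 2 = τ / 2 + 1 / 2 by ring, inv_inv,
    show q ^ 3 * q⁻¹ = q * q by field_simp] at h
  rw [h, ← qProd_mod_three q hq1, show q * q ^ 2 = q ^ 3 by ring]
  ring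

lemma exp_pi_mul_I_zpow (m : ℤ) : exp (Real.pi * I * m) = (-1) ^ m := by
  rw [mul_comm, Complex.exp_int_mul, exp_pi_mul_I]

/-! ### The Köhler–Macdonald identity from a double theta series. -/

section KoehlerMacdonald

variable {τ q : ℂ}

lemma jacobiTheta₂_term_zero_two_mul (hq : q = exp (2 * Real.pi * I * τ)) (i : ℤ) :
    jacobiTheta₂_term i 0 (2 * τ) = q ^ (i ^ 2) := by
  rw [hq, jacobiTheta₂_term, ← Complex.exp_int_mul]
  congr 1
  push_cast
  ring

lemma jacobiTheta₂_term_four_mul (hq : q = exp (2 * Real.pi * I * τ)) (m : ℤ) :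
    jacobiTheta₂_term m (4 * τ / 2 + 1 / 2) (4 * τ) = (-1) ^ m * q ^ (2 * m ^ 2 + 2 * m) := by
  rw [hq, jacobiTheta₂_term, ← Complex.exp_int_mul, ← exp_pi_mul_I_zpow, ← Complex.exp_add]
  congr 1
  push_cast
  ring

lemma jacobiTheta₂_term_twelve_mul (hq : q = exp (2 * Real.pi * I * τ)) (m : ℤ) :
    jacobiTheta₂_term m (4 * τ / 2 + 1 / 2) (3 * (4 * τ)) = (-1) ^ m * q ^ (6 * m ^ 2 + 2 * m) := by
  rw [hq, jacobiTheta₂_term, ← Complex.exp_int_mul, ← exp_pi_mul_I_zpow, ← Complex.exp_add]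
  congr 1
  push_cast
  ring

lemma exp_four_mul (hq : q = exp (2 * Real.pi * I * τ)) :
    q ^ 4 = exp (2 * Real.pi * I * (4 * τ)) := by
  rw [hq, ← Complex.exp_nat_mul]; congr 1; push_cast; ring

/-- The general term of the product of `∑ q ^ (i ^ 2)` with `∑ (-1) ^ m q ^ (2 m ^ 2 + 2 m)`,
in the coordinates `n = i + 2 m + 1` and `m`. -/
noncomputable def thetaProductTerm (q : ℂ) (n m : ℤ) : ℂ :=
  q ^ ((n - 2 * m - 1) ^ 2) * ((-1) ^ m * q ^ (2 * m ^ 2 + 2 * m))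

lemma HasSum.mul_prod {F G : ℤ → ℂ} {a b : ℂ} (hF : HasSum F a) (hG : HasSum G b) :
    HasSum (fun x : ℤ × ℤ ↦ F x.1 * G x.2) (a * b) :=
  hF.mul hG (summable_mul_of_summable_norm hF.summable.norm hG.summable.norm)

/-- The weight is `i + (2 * m + 1)` in the original coordinates; only its part `2 * m` survives the
two vanishing hypotheses. -/
lemma hasSum_mul_shear {F G : ℤ → ℂ} {a b : ℂ} (hF : HasSum F a)
    (hF' : HasSum (fun i : ℤ ↦ (i : ℂ) * F i) 0) (hG : HasSum G 0)
    (hG' : HasSum (fun m : ℤ ↦ (m : ℂ) * G m) b) :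
    HasSum (fun x : ℤ × ℤ ↦ (x.1 : ℂ) * (F (x.1 - 2 * x.2 - 1) * G x.2)) (a * (2 * b)) := by
  have hG2 := (hG'.mul_left 2).add hG
  have h3 := (hF'.mul_prod hG).add (hF.mul_prod hG2)
  rw [zero_mul, zero_add, add_zero] at h3
  let e : ℤ × ℤ ≃ ℤ × ℤ :=
    { toFun := fun x ↦ (x.1 - 2 * x.2 - 1, x.2)
      invFun := fun x ↦ (x.1 + 2 * x.2 + 1, x.2)
      left_inv := fun x ↦ by ext <;> simp; ring
      right_inv := fun x ↦ by ext <;> simp; ring }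
  refine Eq.subst (motive := fun f ↦ HasSum f _) (funext fun x ↦ ?_) (e.hasSum_iff.mpr h3)
  simp only [Function.comp, e, Equiv.coe_fn_mk]
  push_cast
  ring

lemma hasSum_thetaProductTerm (hτ : 0 < τ.im) (hq : q = exp (2 * Real.pi * I * τ)) :
    HasSum (fun x : ℤ × ℤ ↦ (x.1 : ℂ) * thetaProductTerm q x.1 x.2)
      (jacobiTheta₂ 0 (2 * τ) * (2 * qProd (q ^ 4) (q ^ 4) ^ 3)) := by
  have h2 : 0 < (2 * τ).im := by simpa using hτ
  have h4 : 0 < (4 * τ).im := by simpa using hτ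
  have hF := hasSum_jacobiTheta₂_term 0 h2
  have hF' := hasSum_jacobiTheta₂'_term 0 h2
  have hG := hasSum_jacobiTheta₂_term (4 * τ / 2 + 1 / 2) h4
  have hG' := hasSum_jacobiTheta₂'_term (4 * τ / 2 + 1 / 2) h4
  rw [show jacobiTheta₂' 0 (2 * τ) = 0 by
    have := jacobiTheta₂'_neg_left 0 (2 * τ)
    rw [neg_zero] at this
    linear_combination this / 2] at hF'
  rw [jacobiTheta₂_half_period h4] at hG
  rw [jacobiTheta₂'_half_period h4 (exp_four_mul hq)] at hG'
  simp only [jacobiTheta₂'_term, jacobiTheta₂_term_zero_two_mul hq]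
    at hF hF'
  simp only [jacobiTheta₂'_term, jacobiTheta₂_term_four_mul hq] at hG hG'
  have hpi : (2 * Real.pi * I : ℂ) ≠ 0 := two_pi_I_ne_zero
  have hF2 := hF'.mul_left (2 * Real.pi * I)⁻¹
  have hG2 := hG'.mul_left (2 * Real.pi * I)⁻¹
  rw [mul_zero] at hF2
  rw [inv_mul_cancel_left₀ hpi] at hG2
  have hF3 : HasSum (fun i : ℤ ↦ (i : ℂ) * q ^ (i ^ 2)) 0 := by
    refine Eq.subst (motive := fun f ↦ HasSum f _) (funext fun x ↦ ?_) hF2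
    rw [mul_assoc (2 * Real.pi * I : ℂ), inv_mul_cancel_left₀ hpi]
  have hG3 : HasSum (fun m : ℤ ↦ (m : ℂ) * ((-1) ^ m * q ^ (2 * m ^ 2 + 2 * m)))
      (qProd (q ^ 4) (q ^ 4) ^ 3) := by
    refine Eq.subst (motive := fun f ↦ HasSum f _) (funext fun x ↦ ?_) hG2
    rw [mul_assoc (2 * Real.pi * I : ℂ), inv_mul_cancel_left₀ hpi]
  exact hasSum_mul_shear (F := fun i ↦ q ^ (i ^ 2))
    (G := fun m ↦ (-1) ^ m * q ^ (2 * m ^ 2 + 2 * m)) hF hF3 hG hG3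

lemma thetaProductTerm_add (hq0 : q ≠ 0) (n m : ℤ) :
    thetaProductTerm q (n + 3) (m + 1) = -q ^ (2 * n + 3) * thetaProductTerm q n m := by
  simp only [thetaProductTerm]
  rw [zpow_add_one₀ (by norm_num)]
  have : q ^ ((n + 3 - 2 * (m + 1) - 1) ^ 2) * q ^ (2 * (m + 1) ^ 2 + 2 * (m + 1)) =
      q ^ (2 * n + 3) * (q ^ ((n - 2 * m - 1) ^ 2) * q ^ (2 * m ^ 2 + 2 * m)) := by
    rw [← zpow_add₀ hq0, ← zpow_add₀ hq0, ← zpow_add₀ hq0]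
    congr 1
    ring
  linear_combination (-(-1) ^ m) * this

lemma tsum_thetaProductTerm_add_three (hq0 : q ≠ 0) (n : ℤ) :
    ∑' m, thetaProductTerm q (n + 3) m = -q ^ (2 * n + 3) * ∑' m, thetaProductTerm q n m := by
  rw [← (Equiv.addRight (1 : ℤ)).tsum_eq, ← tsum_mul_left]
  exact tsum_congr fun m ↦ thetaProductTerm_add hq0 n m

lemma tsum_thetaProductTerm_zero : ∑' m, thetaProductTerm q 0 m = 0 := by
  have : ∑' m, thetaProductTerm q 0 m = -∑' m, thetaProductTerm q 0 m := by
    -- The reflection `m ↦ -1 - m` preserves the exponent and reverses the sign.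
    conv_lhs => rw [← (Equiv.subLeft (-1 : ℤ)).tsum_eq]
    rw [← tsum_neg]
    refine tsum_congr fun m ↦ ?_
    simp only [thetaProductTerm, Equiv.subLeft_apply]
    rw [zpow_sub₀ (by norm_num), show 0 - 2 * (-1 - m) - 1 = -(0 - 2 * m - 1) by ring, neg_sq,
      show 2 * (-1 - m) ^ 2 + 2 * (-1 - m) = 2 * m ^ 2 + 2 * m by ring]
    rcases Int.even_or_odd m with h | h
    · simp [h.neg_one_zpow]
    · simp [h.neg_one_zpow]
  linear_combination this / 2

/-- At `n = 1` the exponent is `6 * m ^ 2 + 2 * m`, so this is the pentagonal series in `q ^ 4`. -/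
lemma tsum_thetaProductTerm_one (hτ : 0 < τ.im) (hq : q = exp (2 * Real.pi * I * τ)) :
    ∑' m, thetaProductTerm q 1 m = qProd (q ^ 4) (q ^ 4) := by
  have hq0 : q ≠ 0 := hq ▸ exp_ne_zero _
  rw [← jacobiTheta₂_three_mul (τ := 4 * τ) (by simpa using hτ) (exp_four_mul hq), jacobiTheta₂]
  refine tsum_congr fun m ↦ ?_
  rw [jacobiTheta₂_term_twelve_mul hq, thetaProductTerm, mul_left_comm, ← zpow_add₀ hq0]
  congr 2
  ring

lemma tsum_thetaProductTerm_two (hq0 : q ≠ 0) :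
    ∑' m, thetaProductTerm q 2 m = q * ∑' m, thetaProductTerm q 1 m := by
  rw [← (Equiv.neg ℤ).tsum_eq, ← tsum_mul_left]
  refine tsum_congr fun m ↦ ?_
  simp only [thetaProductTerm, Equiv.neg_apply]
  rw [mul_left_comm, ← zpow_add₀ hq0, mul_left_comm (q ^ ((1 - 2 * m - 1) ^ 2)), ← zpow_add₀ hq0,
    mul_left_comm q, ← zpow_one_add₀ hq0, zpow_neg, ← inv_zpow, inv_neg_one]
  congr 2
  ring

/-- Since `c` never vanishes, the recurrence runs backwards too, and three initial values determine
the sequence on `ℤ`. -/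
lemma eq_of_add_three_eq_mul {X Y c : ℤ → ℂ} (hc : ∀ n, c n ≠ 0)
    (hX : ∀ n, X (n + 3) = c n * X n) (hY : ∀ n, Y (n + 3) = c n * Y n)
    (h0 : X 0 = Y 0) (h1 : X 1 = Y 1) (h2 : X 2 = Y 2) : X = Y := by
  have step (n : ℤ) : X n = Y n ↔ X (n + 3) = Y (n + 3) := by
    rw [hX, hY, mul_right_inj' (hc n)]
  have key (k r : ℤ) (hr : X r = Y r) : X (r + 3 * k) = Y (r + 3 * k) := by
    induction k with
    | zero => simpa using hr
    | succ k ih =>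
      rw [mul_add, ← add_assoc]
      exact (step _).mp ih
    | pred k ih =>
      rw [step]
      convert ih using 2 <;> ring
  ext n
  have h := Int.emod_add_mul_ediv n 3
  rw [← h]
  apply key
  have : n % 3 = 0 ∨ n % 3 = 1 ∨ n % 3 = 2 := by omega
  rcases this with h | h | h <;> rw [h] <;> assumption

lemma legendreSym_three_add_three (n : ℤ) : legendreSym 3 (n + 3) = legendreSym 3 n := by
  rw [legendreSym.mod 3 (n + 3), legendreSym.mod 3 n]
  simp

lemma legendreSym_three_neg (n : ℤ) : legendreSym 3 (-n) = -legendreSym 3 n := by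
  rw [neg_eq_neg_one_mul, legendreSym.mul, show legendreSym 3 (-1) = -1 by norm_num]
  ring

lemma mul_tsum_thetaProductTerm (hτ : 0 < τ.im) (hq : q = exp (2 * Real.pi * I * τ))
    {w : ℂ} (hw : w ^ 3 = q) (n : ℤ) :
    w * ∑' m, thetaProductTerm q n m = qProd (q ^ 4) (q ^ 4) *
      ((-1) ^ (n - 1) * (legendreSym 3 n : ℂ) * w ^ (n ^ 2)) := by
  have hq0 : q ≠ 0 := hq ▸ exp_ne_zero _
  have hw0 : w ≠ 0 := by rintro rfl; simp [← hw] at hq0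
  refine congr_fun (eq_of_add_three_eq_mul (c := fun n ↦ -q ^ (2 * n + 3))
    (X := fun n ↦ w * ∑' m, thetaProductTerm q n m)
    (Y := fun n ↦ qProd (q ^ 4) (q ^ 4) * ((-1) ^ (n - 1) * (legendreSym 3 n : ℂ) * w ^ (n ^ 2)))
    (fun n ↦ neg_ne_zero.mpr (zpow_ne_zero _ hq0)) (fun n ↦ ?_) (fun n ↦ ?_) ?_ ?_ ?_) n
  · simp only [tsum_thetaProductTerm_add_three hq0]
    ring
  · rw [legendreSym_three_add_three, ← hw, show n + 3 - 1 = n - 1 + 3 by ring,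
      zpow_add₀ (by norm_num) (n - 1) 3]
    have : w ^ ((n + 3) ^ 2) = (w ^ 3) ^ (2 * n + 3) * w ^ (n ^ 2) := by
      rw [← zpow_natCast, ← zpow_mul, ← zpow_add₀ hw0]
      congr 1
      push_cast
      ring
    rw [this]
    norm_num
    ring
  · simp [tsum_thetaProductTerm_zero]
  · simp [tsum_thetaProductTerm_one hτ hq, mul_comm]
  · rw [tsum_thetaProductTerm_two hq0, tsum_thetaProductTerm_one hτ hq,
      show legendreSym 3 2 = -1 by norm_num, show (2 : ℤ) ^ 2 = (4 : ℕ) by norm_num, zpow_natCast]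
    generalize qProd (q ^ 4) (q ^ 4) = e
    rw [← hw]
    norm_num
    ring

theorem hasSum_koehler_macdonald (hτ : 0 < τ.im) :
    HasSum (fun n : ℕ+ ↦ (-1 : ℂ) ^ ((n : ℕ) - 1) * ((n : ℕ) : ℂ) *
        ((legendreSym 3 ((n : ℕ) : ℤ) : ℤ) : ℂ) *
        exp (2 * Real.pi * I * ((n : ℕ) : ℂ) ^ 2 * τ / 3))
      (ModularForm.eta (2 * τ) ^ 5 / ModularForm.eta τ ^ 2) := by
  obtain ⟨q, hq⟩ : ∃ q, q = exp (2 * Real.pi * I * τ) := ⟨_, rfl⟩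
  obtain ⟨w, hw⟩ : ∃ w, w = exp (2 * Real.pi * I * τ / 3) := ⟨_, rfl⟩
  have hw3 : w ^ 3 = q := by rw [hq, hw, ← Complex.exp_nat_mul]; congr 1; push_cast; ring
  have hq1 : ‖q‖ < 1 := hq ▸ norm_exp_two_pi_mul_I_lt_one hτ
  have he (k : ℕ) (hk : k ≠ 0) : qProd (q ^ k) (q ^ k) ≠ 0 :=
    qProd_ne_zero_of_norm_lt_one (norm_pow_lt_one hq1 hk) (norm_pow_lt_one hq1 hk)
  have he1 : qProd q q ≠ 0 := by simpa using he 1 one_ne_zero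
  have he4 := he 4 (by norm_num)
  have hsum := hasSum_thetaProductTerm hτ hq
  have hfib := hsum.prod_fiberwise fun n ↦ (hsum.summable.prod_factor n).hasSum
  simp only [tsum_mul_left] at hfib
  -- Pairing `n` with `-n` doubles each term, as the summand is even, and cancels the factor `2`;
  -- the extra term at `0` vanishes.
  have hZ := (hfib.mul_left (w / (2 * qProd (q ^ 4) (q ^ 4)))).nat_add_neg
  have hval : ModularForm.eta (2 * τ) ^ 5 / ModularForm.eta τ ^ 2 =
      w / (2 * qProd (q ^ 4) (q ^ 4)) *
      (jacobiTheta₂ 0 (2 * τ) * (2 * qProd (q ^ 4) (q ^ 4) ^ 3)) := by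
    have hφ := jacobiTheta₂_zero_two_mul hτ hq
    have h2 : exp (2 * Real.pi * I * (2 * τ)) = q ^ 2 := by
      rw [hq, ← Complex.exp_nat_mul]; congr 1; push_cast; ring
    rw [eta_eq_exp_mul_qProd, eta_eq_exp_mul_qProd, h2, ← hq]
    -- The exponents of the eta factors leave `10/24 - 2/24 = 1/3`, which is `w`.
    have h24 : exp (2 * Real.pi * I * (2 * τ) / 24) ^ 5 =
        exp (2 * Real.pi * I * τ / 24) ^ 2 * w := by
      rw [hw, ← Complex.exp_nat_mul, ← Complex.exp_nat_mul, ← Complex.exp_add]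
      congr 1; push_cast; ring
    have hne := exp_ne_zero (2 * Real.pi * I * τ / 24)
    rw [mul_pow, mul_pow, h24, ← hφ]
    field_simp
  rw [hval]
  have hterm (n : ℤ) : w / (2 * qProd (q ^ 4) (q ^ 4)) * (n * ∑' m, thetaProductTerm q n m) =
      n * ((-1) ^ (n - 1) * (legendreSym 3 n : ℂ) * w ^ (n ^ 2)) / 2 := by
    have := mul_tsum_thetaProductTerm hτ hq hw3 n
    field_simp
    linear_combination n * this
  simp only [hterm] at hZ
  simp only [Int.cast_zero, zero_mul, zero_div, add_zero] at hZ
  rw [← PNat.coe_injective.hasSum_iff] at hZ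
  · refine Eq.subst (motive := fun f ↦ HasSum f _) (funext fun n ↦ ?_) hZ
    obtain ⟨k, hk⟩ : ∃ k : ℕ, (n : ℕ) = k + 1 := ⟨n - 1, by have := n.pos; omega⟩
    simp only [Function.comp, hk]
    have h1 : exp (2 * Real.pi * I * ((k + 1 : ℕ) : ℂ) ^ 2 * τ / 3) =
        w ^ (((k + 1 : ℕ) : ℤ) ^ 2) := by
      rw [hw, ← Complex.exp_int_mul]; congr 1; push_cast; ring
    rw [h1, legendreSym_three_neg, neg_sq, show -((k + 1 : ℕ) : ℤ) - 1 = k + 2 * (-(k + 1)) by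
      push_cast; ring, zpow_add₀ (by norm_num), zpow_mul]
    push_cast
    simp
    ring
  · intro n hn
    have : n = 0 := by
      by_contra h
      exact hn ⟨⟨n, Nat.pos_of_ne_zero h⟩, rfl⟩
    simp [this]

end KoehlerMacdonald

/-! ### Lambert series of the odd character modulo 6. -/

/-- The odd character modulo `6`: the indicator of `1` minus the indicator of `5`. -/
noncomputable def charModSix (a : ℕ) : ℂ :=
  (if a ≡ 1 [MOD 6] then 1 else 0) - (if a ≡ 5 [MOD 6] then 1 else 0)

lemma charModSix_add_six (a : ℕ) : charModSix (a + 6) = charModSix a := by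
  simp [charModSix, Nat.ModEq]

lemma norm_charModSix_le (a : ℕ) : ‖charModSix a‖ ≤ 1 := by
  rw [charModSix]
  split_ifs with h1 h2
  · exact absurd (h1.symm.trans h2) (by decide)
  all_goals simp

lemma sum_divisors_charModSix (n : ℕ) :
    ∑ d ∈ n.divisors, charModSix d = (divisorCountMod 1 6 n : ℂ) - divisorCountMod 5 6 n := by
  simp [charModSix, divisorCountMod, Finset.sum_sub_distrib]

lemma summable_charModSix {r : ℂ} (hr : ‖r‖ < 1) : Summable fun a : ℕ ↦ charModSix a * r ^ a := by
  refine Summable.of_norm_bounded (summable_geometric_of_lt_one (norm_nonneg r) hr) fun a ↦ ?_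
  rw [norm_mul, norm_pow]
  exact mul_le_of_le_one_left (by positivity) (norm_charModSix_le a)

lemma tsum_charModSix {r : ℂ} (hr : ‖r‖ < 1) :
    ∑' a : ℕ+, charModSix a * r ^ (a : ℕ) = (r - r ^ 5) / (1 - r ^ 6) := by
  have hs := summable_charModSix hr
  have h0 : charModSix 0 * r ^ 0 = 0 := by simp [charModSix, Nat.ModEq]
  have h1 := tsum_zero_pnat_eq_tsum_nat hs
  rw [h0, zero_add] at h1
  have hr6 : 1 - r ^ 6 ≠ 0 := by
    rw [pow_succ']
    exact one_sub_mul_pow_ne_zero hr hr 5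
  rw [h1, eq_div_iff hr6]
  have h2 := hs.sum_add_tsum_nat_add 6
  -- Periodicity: removing the first six terms multiplies the series by `r ^ 6`.
  simp only [charModSix_add_six, pow_add, ← mul_assoc, tsum_mul_right] at h2
  generalize ∑' a, charModSix a * r ^ a = S at h2 ⊢
  simp [Finset.sum_range_succ, charModSix, Nat.ModEq] at h2
  linear_combination -h2

lemma summable_charModSix_prod {q : ℂ} (hq : ‖q‖ < 1) :
    Summable fun c : ℕ+ × ℕ+ ↦ charModSix c.1 * q ^ (c.1 * c.2 : ℕ) := by
  refine Summable.of_norm_bounded (summable_prod_mul_pow 0 hq).norm fun c ↦ ?_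
  rw [norm_mul, norm_mul, pow_zero, norm_one]
  exact mul_le_mul_of_nonneg_right (norm_charModSix_le _) (norm_nonneg _)

lemma hasSum_divisorCountMod {q : ℂ} (hq : ‖q‖ < 1) :
    HasSum (fun n : ℕ+ ↦ ((divisorCountMod 1 6 n : ℂ) - divisorCountMod 5 6 n) * q ^ (n : ℕ))
      (∑' c : ℕ+ × ℕ+, charModSix c.1 * q ^ (c.1 * c.2 : ℕ)) := by
  have h := sigmaAntidiagonalEquivProd.hasSum_iff.mpr (summable_charModSix_prod hq).hasSum
  refine Eq.subst (motive := fun f ↦ HasSum f _) (funext fun n ↦ ?_)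
    (h.sigma fun n ↦ hasSum_fintype _)
  simp only [Function.comp, sigmaAntidiagonalEquivProd, divisorsAntidiagonalFactors,
    Equiv.coe_fn_mk, PNat.mk_coe, Finset.univ_eq_attach]
  rw [(n : ℕ).divisorsAntidiagonal.sum_attach (fun x : ℕ × ℕ ↦ charModSix x.1 * q ^ (x.1 * x.2)),
    Nat.sum_divisorsAntidiagonal (fun x y ↦ charModSix x * q ^ (x * y)),
    ← sum_divisors_charModSix, Finset.sum_mul]
  exact Finset.sum_congr rfl fun i hi ↦ by rw [Nat.mul_div_cancel' (Nat.dvd_of_mem_divisors hi)]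

/-- The same absolutely convergent double series, now summed over the divisor first with the
cofactor `n + 1` fixed. -/
lemma hasSum_lambert_charModSix {q : ℂ} (hq : ‖q‖ < 1) :
    HasSum (fun n : ℕ ↦ (q ^ (n + 1) - (q ^ (n + 1)) ^ 5) / (1 - (q ^ (n + 1)) ^ 6))
      (∑' n : ℕ+, ((divisorCountMod 1 6 n : ℂ) - divisorCountMod 5 6 n) * q ^ (n : ℕ)) := by
  rw [(hasSum_divisorCountMod hq).tsum_eq]
  have h := (Equiv.prodComm ℕ+ ℕ+).hasSum_iff.mpr (summable_charModSix_prod hq).hasSum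
  have h2 := h.prod_fiberwise fun b ↦ (h.summable.prod_factor b).hasSum
  rw [← Equiv.pnatEquivNat.symm.hasSum_iff] at h2
  refine Eq.subst (motive := fun f ↦ HasSum f _) (funext fun n ↦ ?_) h2
  simp only [Function.comp, Equiv.prodComm_apply, Prod.swap, Equiv.pnatEquivNat_symm_apply,
    Nat.succPNat_coe, Nat.succ_eq_add_one]
  rw [← tsum_charModSix (norm_pow_lt_one hq n.succ_ne_zero)]
  exact tsum_congr fun a ↦ by rw [← pow_mul, mul_comm (n + 1)]

/-! ### Addition formula and logarithmic derivative of theta. -/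

/-- The addition formula for a product of two theta functions. -/
lemma jacobiTheta₂_mul_jacobiTheta₂ (z w : ℂ) {τ : ℂ} (hτ : 0 < τ.im) :
    jacobiTheta₂ z τ * jacobiTheta₂ w τ =
      jacobiTheta₂ (z + w) (2 * τ) * jacobiTheta₂ (z - w) (2 * τ) +
      exp (2 * Real.pi * I * z + Real.pi * I * τ) *
        (jacobiTheta₂ (z + w + τ) (2 * τ) * jacobiTheta₂ (z - w + τ) (2 * τ)) := by
  have h2 : 0 < (2 * τ).im := by simpa using hτ
  have hL := (hasSum_jacobiTheta₂_term z hτ).mul_prod (hasSum_jacobiTheta₂_term w hτ)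
  have hE := (hasSum_jacobiTheta₂_term (z + w) h2).mul_prod (hasSum_jacobiTheta₂_term (z - w) h2)
  have hO := ((hasSum_jacobiTheta₂_term (z + w + τ) h2).mul_prod
    (hasSum_jacobiTheta₂_term (z - w + τ) h2)).mul_left
      (exp (2 * Real.pi * I * z + Real.pi * I * τ))
  -- Index pairs split by the parity of their sum; `e` parametrises the even class and `o` the odd
  -- one, and both diagonalise the sum of squares.
  let e : ℤ × ℤ → ℤ × ℤ := fun x ↦ (x.1 + x.2, x.1 - x.2)
  let o : ℤ × ℤ → ℤ × ℤ := fun x ↦ (x.1 + x.2 + 1, x.1 - x.2)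
  have he : Function.Injective e := by
    intro x y h
    simp only [e, Prod.mk.injEq] at h
    ext <;> omega
  have ho : Function.Injective o := by
    intro x y h
    simp only [o, Prod.mk.injEq] at h
    ext <;> omega
  have heo : IsCompl (Set.range e) (Set.range o) := by
    constructor
    · rw [Set.disjoint_left]
      rintro _ ⟨x, rfl⟩ ⟨y, h⟩
      simp only [e, o, Prod.mk.injEq] at h
      omega
    · rw [codisjoint_iff_le_sup]
      rintro ⟨m, n⟩ -
      rcases Int.even_or_odd (m + n) with ⟨k, hk⟩ | ⟨k, hk⟩
      · exact Or.inl ⟨(k, m - k), by simp only [e, Prod.mk.injEq]; omega⟩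
      · exact Or.inr ⟨(k, m - k - 1), by simp only [o, Prod.mk.injEq]; omega⟩
  have hfe : HasSum ((fun x : ℤ × ℤ ↦ jacobiTheta₂_term x.1 z τ * jacobiTheta₂_term x.2 w τ) ∘ e)
      (jacobiTheta₂ (z + w) (2 * τ) * jacobiTheta₂ (z - w) (2 * τ)) := by
    refine Eq.subst (motive := fun f ↦ HasSum f _) (funext fun x ↦ ?_) hE
    simp only [Function.comp, e, jacobiTheta₂_term, ← Complex.exp_add]
    congr 1
    push_cast
    ring
  have hfo : HasSum ((fun x : ℤ × ℤ ↦ jacobiTheta₂_term x.1 z τ * jacobiTheta₂_term x.2 w τ) ∘ o)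
      (exp (2 * Real.pi * I * z + Real.pi * I * τ) *
        (jacobiTheta₂ (z + w + τ) (2 * τ) * jacobiTheta₂ (z - w + τ) (2 * τ))) := by
    refine Eq.subst (motive := fun f ↦ HasSum f _) (funext fun x ↦ ?_) hO
    simp only [Function.comp, o, jacobiTheta₂_term, ← Complex.exp_add]
    congr 1
    push_cast
    ring
  exact hL.unique (HasSum.add_isCompl heo (he.hasSum_range_iff.mpr hfe)
    (ho.hasSum_range_iff.mpr hfo))

lemma hasDerivAt_qProd {q x : ℂ} (hq : ‖q‖ < 1) (hx : ∀ n : ℕ, 1 - x * q ^ n ≠ 0) :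
    HasDerivAt (qProd · q) (qProd x q * ∑' n : ℕ, -(q ^ n / (1 - x * q ^ n))) x := by
  obtain ⟨hd, hl⟩ := differentiable_qProd hq
  have h := (hd x).hasDerivAt
  rwa [← hl x hx, logDeriv_apply, mul_div_cancel₀ _ (qProd_ne_zero hq hx)]

/-- The general term of the logarithmic derivative of the theta function. -/
noncomputable def thetaLambertTerm (y q : ℂ) (n : ℕ) : ℂ :=
  y⁻¹ * q ^ (n + 1) / (1 - y⁻¹ * q ^ (n + 1)) - y * q ^ (n + 1) / (1 - y * q ^ (n + 1))

lemma summable_div_one_sub {q : ℂ} (hq : ‖q‖ < 1) (x : ℂ) :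
    Summable fun n : ℕ ↦ x * q ^ (n + 1) / (1 - x * q ^ (n + 1)) := by
  have ht : Tendsto (fun n : ℕ ↦ ‖(1 - x * q ^ n)⁻¹‖) atTop (𝓝 ‖(1 - x * 0)⁻¹‖) :=
    (((tendsto_pow_atTop_nhds_zero_of_norm_lt_one hq).const_mul x).const_sub 1
      |>.inv₀ (by simp)).norm
  obtain ⟨C, hC⟩ := ht.bddAbove_range
  refine (summable_nat_add_iff (f := fun n : ℕ ↦ x * q ^ n / (1 - x * q ^ n)) 1).mpr
    (Summable.of_norm_bounded
      ((summable_geometric_of_lt_one (norm_nonneg _) hq).mul_left (C * ‖x‖)) fun n ↦ ?_)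
  rw [div_eq_inv_mul, norm_mul, norm_mul, norm_pow, ← mul_assoc]
  gcongr
  exact hC ⟨n, rfl⟩

lemma summable_thetaLambertTerm {q : ℂ} (hq : ‖q‖ < 1) (y : ℂ) :
    Summable (thetaLambertTerm y q) :=
  (summable_div_one_sub hq _).sub (summable_div_one_sub hq _)

lemma hasDerivAt_jacobiTheta₂_half_period_add (s : ℂ) {τ : ℂ} (hτ : 0 < τ.im) {q y : ℂ}
    (hq : q = exp (2 * Real.pi * I * τ)) (hy : y = exp (2 * Real.pi * I * s))
    (hy1 : y ≠ 1) (hyn : ‖y‖ = 1) :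
    HasDerivAt (fun x ↦ jacobiTheta₂ (s + x + τ / 2 + 1 / 2) τ)
      (jacobiTheta₂ (s + τ / 2 + 1 / 2) τ *
        (2 * Real.pi * I * (1 / (y - 1) + ∑' n, thetaLambertTerm y q n))) 0 := by
  have hq1 : ‖q‖ < 1 := hq ▸ norm_exp_two_pi_mul_I_lt_one hτ
  have hy0 : y ≠ 0 := hy ▸ exp_ne_zero _
  have hE : HasDerivAt (fun x : ℂ ↦ exp (2 * Real.pi * I * x)) (2 * Real.pi * I) 0 := by
    simpa using ((hasDerivAt_id (0 : ℂ)).const_mul (2 * Real.pi * I)).cexp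
  have hEi : HasDerivAt (fun x : ℂ ↦ (exp (2 * Real.pi * I * x))⁻¹) (-(2 * Real.pi * I)) 0 := by
    simpa using! hE.inv (by simp)
  have hn1 : ‖q * y‖ < 1 := by rwa [norm_mul, hyn, mul_one]
  have hn2 : ‖q * y⁻¹‖ < 1 := by rwa [norm_mul, norm_inv, hyn, inv_one, mul_one]
  have d1 := HasDerivAt.comp (0 : ℂ) (h₂ := (qProd · q))
    (h := fun x : ℂ ↦ q * y * exp (2 * Real.pi * I * x))
    (by simpa using! hasDerivAt_qProd hq1 (one_sub_mul_pow_ne_zero hq1 hn1)) (hE.const_mul (q * y))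
  have d2 := HasDerivAt.comp (0 : ℂ) (h₂ := (qProd · q))
    (h := fun x : ℂ ↦ q * y⁻¹ * (exp (2 * Real.pi * I * x))⁻¹)
    (by simpa using! hasDerivAt_qProd hq1 (one_sub_mul_pow_ne_zero hq1 hn2))
    (hEi.const_mul (q * y⁻¹))
  have d3 := (hEi.const_mul y⁻¹).const_sub 1
  have hfun (x : ℂ) : jacobiTheta₂ (s + x + τ / 2 + 1 / 2) τ =
      qProd q q * (qProd (q * y * exp (2 * Real.pi * I * x)) q *
        ((1 - y⁻¹ * (exp (2 * Real.pi * I * x))⁻¹) *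
          qProd (q * y⁻¹ * (exp (2 * Real.pi * I * x))⁻¹) q)) := by
    rw [jacobiTheta₂_add_half_period (s + x) hτ hq (x := y * exp (2 * Real.pi * I * x))
      (by rw [hy, ← Complex.exp_add]; congr 1; ring),
      qProd_eq_one_sub_mul (y * exp (2 * Real.pi * I * x))⁻¹ hq1, mul_inv]
    congr 3
    · ring
    · congr 1; ring
  have d := (d1.mul (d3.mul d2)).const_mul (qProd q q)
  have h0 := hfun 0
  rw [add_zero] at h0
  simp only [hfun, h0]
  refine d.congr_deriv ?_
  have hs : ∑' n, thetaLambertTerm y q n =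
      q * y * ∑' n : ℕ, -(q ^ n / (1 - q * y * q ^ n)) -
      q * y⁻¹ * ∑' n : ℕ, -(q ^ n / (1 - q * y⁻¹ * q ^ n)) := by
    rw [← tsum_mul_left, ← tsum_mul_left]
    simp only [thetaLambertTerm]
    rw [(summable_div_one_sub hq1 _).tsum_sub (summable_div_one_sub hq1 _), sub_eq_neg_add,
      ← tsum_neg, sub_eq_add_neg, ← tsum_neg]
    congr 1 <;> exact tsum_congr fun n ↦ by ring_nf
  rw [hs]
  have hy2 : y - 1 ≠ 0 := sub_ne_zero.mpr hy1
  simp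
  field_simp
  ring

/-! ### The weight-one eta quotient. -/

section WeightOne

variable {τ q ζ : ℂ}

lemma jacobiTheta₂'_one_half (τ : ℂ) : jacobiTheta₂' (1 / 2) τ = 0 := by
  have h1 := jacobiTheta₂'_neg_left (1 / 2) τ
  have h2 := jacobiTheta₂'_add_left (-(1 / 2)) τ
  rw [show -(1 / 2 : ℂ) + 1 = 1 / 2 by norm_num] at h2
  linear_combination (h1 + h2) / 2

/-- The twist by `exp (2πix)` cancels the `x`-dependence of the quasi-period factor, so the last
summand is a constant times a function even in `x`. -/
lemma exp_mul_jacobiTheta₂_mul_jacobiTheta₂ (hτ : 0 < τ.im) (x : ℂ) :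
    exp (2 * Real.pi * I * x) * (jacobiTheta₂ (1 / 6 + x + τ / 2 + 1 / 2) τ *
      jacobiTheta₂ (1 / 3 + x + τ / 2 + 1 / 2) τ) =
    exp (2 * Real.pi * I * x) * jacobiTheta₂ (2 * x + (2 * τ / 2 + 1 / 2)) (2 * τ) *
      jacobiTheta₂ (1 / 6) (2 * τ) +
    exp (2 * Real.pi * I * (1 / 6 + τ / 2 + 1 / 2) + Real.pi * I * τ - Real.pi * I * (2 * τ + 1)) *
      jacobiTheta₂ (τ - 1 / 6) (2 * τ) * jacobiTheta₂ (2 * x + 1 / 2) (2 * τ) := by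
  rw [jacobiTheta₂_mul_jacobiTheta₂ _ _ hτ,
    show 1 / 6 + x + τ / 2 + 1 / 2 + (1 / 3 + x + τ / 2 + 1 / 2) + τ =
      2 * x + 1 / 2 + 2 * τ + 1 by ring,
    show 1 / 6 + x + τ / 2 + 1 / 2 + (1 / 3 + x + τ / 2 + 1 / 2) =
      2 * x + (2 * τ / 2 + 1 / 2) + 1 by ring,
    show 1 / 6 + x + τ / 2 + 1 / 2 - (1 / 3 + x + τ / 2 + 1 / 2) + τ = τ - 1 / 6 by ring,
    show 1 / 6 + x + τ / 2 + 1 / 2 - (1 / 3 + x + τ / 2 + 1 / 2) = -(1 / 6) by ring,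
    jacobiTheta₂_add_left, jacobiTheta₂_add_left, jacobiTheta₂_add_left', jacobiTheta₂_neg_left]
  have : exp (2 * Real.pi * I * (1 / 6 + τ / 2 + 1 / 2) + Real.pi * I * τ -
      Real.pi * I * (2 * τ + 1)) =
      exp (2 * Real.pi * I * x) * (exp (2 * Real.pi * I * (1 / 6 + x + τ / 2 + 1 / 2) +
        Real.pi * I * τ) * exp (-Real.pi * I * (2 * τ + 2 * (2 * x + 1 / 2)))) := by
    rw [← Complex.exp_add, ← Complex.exp_add]
    congr 1
    ring
  rw [this]
  ring

lemma hasDerivAt_exp_mul_jacobiTheta₂_mul_jacobiTheta₂ (hτ : 0 < τ.im)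
    (hq : q = exp (2 * Real.pi * I * τ)) :
    HasDerivAt (fun x ↦ exp (2 * Real.pi * I * x) *
      (jacobiTheta₂ (1 / 6 + x + τ / 2 + 1 / 2) τ * jacobiTheta₂ (1 / 3 + x + τ / 2 + 1 / 2) τ))
      (4 * Real.pi * I * qProd (q ^ 2) (q ^ 2) ^ 3 * jacobiTheta₂ (1 / 6) (2 * τ)) 0 := by
  have h2 : 0 < (2 * τ).im := by simpa using hτ
  have hq2 : q ^ 2 = exp (2 * Real.pi * I * (2 * τ)) := by
    rw [hq, ← Complex.exp_nat_mul]; congr 1; push_cast; ring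
  have hE : HasDerivAt (fun x : ℂ ↦ exp (2 * Real.pi * I * x)) (2 * Real.pi * I) 0 := by
    simpa using ((hasDerivAt_id (0 : ℂ)).const_mul (2 * Real.pi * I)).cexp
  have hθ (c : ℂ) : HasDerivAt (fun x ↦ jacobiTheta₂ (2 * x + c) (2 * τ))
      (jacobiTheta₂' c (2 * τ) * 2) 0 := by
    refine HasDerivAt.comp (0 : ℂ) (h₂ := (jacobiTheta₂ · (2 * τ))) (h := fun x ↦ 2 * x + c)
      (by simpa using hasDerivAt_jacobiTheta₂_fst c h2) ?_
    simpa using ((hasDerivAt_id (0 : ℂ)).const_mul 2).add_const c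
  have h := ((hE.mul (hθ (2 * τ / 2 + 1 / 2))).mul_const (jacobiTheta₂ (1 / 6) (2 * τ))).add
    ((hθ (1 / 2)).const_mul (exp (2 * Real.pi * I * (1 / 6 + τ / 2 + 1 / 2) + Real.pi * I * τ -
      Real.pi * I * (2 * τ + 1)) * jacobiTheta₂ (τ - 1 / 6) (2 * τ)))
  simp only [exp_mul_jacobiTheta₂_mul_jacobiTheta₂ hτ]
  refine h.congr_deriv ?_
  rw [jacobiTheta₂'_one_half, jacobiTheta₂'_half_period h2 hq2, mul_zero (2 : ℂ), zero_add,
    jacobiTheta₂_half_period h2, mul_zero (2 * Real.pi * I), exp_zero]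
  ring

lemma exp_pi_div_three (hζ : ζ = exp (2 * Real.pi * I * (1 / 6))) : ζ ^ 2 = ζ - 1 := by
  have h3 : ζ ^ 3 = -1 := by
    rw [hζ, ← Complex.exp_nat_mul, ← exp_pi_mul_I]; congr 1; push_cast; ring
  have hre : ζ.re = 1 / 2 := by
    rw [hζ, show 2 * Real.pi * I * (1 / 6) = ((Real.pi / 3 : ℝ) : ℂ) * I by push_cast; ring,
      exp_ofReal_mul_I_re, Real.cos_pi_div_three]
  have hne : ζ + 1 ≠ 0 := by
    intro h
    have := congr_arg Complex.re h
    norm_num [hre] at this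
  have : (ζ + 1) * (ζ ^ 2 - ζ + 1) = 0 := by linear_combination h3
  linear_combination (mul_eq_zero.mp this).resolve_left hne

lemma inv_exp_pi_div_three (hζ : ζ = exp (2 * Real.pi * I * (1 / 6))) : ζ⁻¹ = 1 - ζ := by
  have hζ0 : ζ ≠ 0 := hζ ▸ exp_ne_zero _
  field_simp
  linear_combination exp_pi_div_three hζ

lemma qProd_neg_self (hq : ‖q‖ < 1) : qProd (-q) q * qProd q q = qProd (q ^ 2) (q ^ 2) := by
  rw [mul_comm, qProd_mul_qProd_neg q hq]

/-- `-ζ` and `-ζ⁻¹` are the primitive cube roots of unity; the missing third factor is supplied by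
`qProd q (q ^ 2)`. -/
lemma jacobiTheta₂_one_sixth (hτ : 0 < τ.im) (hq : q = exp (2 * Real.pi * I * τ))
    (hζ : ζ = exp (2 * Real.pi * I * (1 / 6))) :
    jacobiTheta₂ (1 / 6) (2 * τ) * (qProd q q * qProd (q ^ 6) (q ^ 6)) =
      qProd (q ^ 2) (q ^ 2) ^ 2 * qProd (q ^ 3) (q ^ 3) := by
  have hq1 : ‖q‖ < 1 := hq ▸ norm_exp_two_pi_mul_I_lt_one hτ
  have hζ2 := exp_pi_div_three hζ
  have hζ0 : ζ ≠ 0 := hζ ▸ exp_ne_zero _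
  rw [jacobiTheta₂_eq_qProd (p := q) (u := ζ) (1 / 6) (by simpa using hτ)
    (by rw [hq]; congr 1; ring) hζ,
    show -(q * ζ) = (ζ ^ 2) ^ 2 * q by linear_combination (-q * ζ ^ 2 - q * ζ) * hζ2,
    show -(q / ζ) = ζ ^ 2 * q by field_simp; linear_combination (-q * (ζ + 1)) * hζ2]
  have h1 := qProd_mul_qProd_mul_qProd (ω := ζ ^ 2)
    (by linear_combination (ζ ^ 2 + ζ + 1) * hζ2) q (norm_pow_lt_one hq1 two_ne_zero)
  have h2 := qProd_sq_of_norm_lt_one hq1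
  have h3 := qProd_sq_of_norm_lt_one (norm_pow_lt_one hq1 three_ne_zero)
  rw [show (q ^ 2) ^ 3 = q ^ 6 by ring] at h1
  rw [show (q ^ 3) ^ 2 = q ^ 6 by ring] at h3
  rw [← h2, ← h3, ← h1]
  ring

/-- The factors group into cube-root triples, at `-q` for `1/6` and at `q` for `1/3`; the leftover
`(1 - ζ⁻¹) * (1 - ζ⁻²)` equals `2 * ζ - 1`. -/
lemma jacobiTheta₂_mul_half_period_add (hτ : 0 < τ.im) (hq : q = exp (2 * Real.pi * I * τ))
    (hζ : ζ = exp (2 * Real.pi * I * (1 / 6))) :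
    jacobiTheta₂ (1 / 6 + τ / 2 + 1 / 2) τ * jacobiTheta₂ (1 / 3 + τ / 2 + 1 / 2) τ *
      qProd (q ^ 2) (q ^ 2) = (2 * ζ - 1) * qProd q q ^ 2 * qProd (q ^ 6) (q ^ 6) := by
  have hq1 : ‖q‖ < 1 := hq ▸ norm_exp_two_pi_mul_I_lt_one hτ
  have hζ2 := exp_pi_div_three hζ
  have hζ0 : ζ ≠ 0 := hζ ▸ exp_ne_zero _
  have hζi := inv_exp_pi_div_three hζ
  have hω : ζ ^ 2 = exp (2 * Real.pi * I * (1 / 3)) := by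
    rw [hζ, ← Complex.exp_nat_mul]; congr 1; push_cast; ring
  rw [jacobiTheta₂_add_half_period _ hτ hq hζ, jacobiTheta₂_add_half_period _ hτ hq hω,
    qProd_eq_one_sub_mul ζ⁻¹ hq1, qProd_eq_one_sub_mul (ζ ^ 2)⁻¹ hq1, ← inv_pow, hζi,
    show (1 - ζ) ^ 2 = (ζ ^ 2) ^ 2 by linear_combination (-(ζ ^ 2 + ζ - 1)) * hζ2,
    show q * ζ = (ζ ^ 2) ^ 2 * (-q) by linear_combination (q * ζ ^ 2 + q * ζ) * hζ2,
    show (1 - ζ) * q = ζ ^ 2 * (-q) by linear_combination q * hζ2, mul_comm q (ζ ^ 2)]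
  have h0 : (ζ ^ 2) ^ 2 + ζ ^ 2 + 1 = 0 := by linear_combination (ζ ^ 2 + ζ + 1) * hζ2
  have h1 := qProd_mul_qProd_mul_qProd h0 q hq1
  have h2 := qProd_mul_qProd_mul_qProd h0 (-q) hq1
  have h3 := qProd_neg_self hq1
  have h4 := qProd_neg_self (norm_pow_lt_one hq1 three_ne_zero)
  rw [neg_pow, Odd.neg_one_pow (by decide), neg_one_mul] at h2
  rw [show (q ^ 3) ^ 2 = q ^ 6 by ring] at h4
  rw [← h3, ← h4, ← h2, ← h1]
  generalize qProd ((ζ ^ 2) ^ 2 * -q) q = b'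
  generalize qProd (ζ ^ 2 * -q) q = a'
  generalize qProd ((ζ ^ 2) ^ 2 * q) q = b
  generalize qProd (ζ ^ 2 * q) q = a
  generalize qProd (-q) q = c
  generalize qProd q q = e
  linear_combination (-(e ^ 3 * c * a * b * a' * b') * (ζ ^ 3 + ζ ^ 2 - 1)) * hζ2

lemma thetaLambertTerm_add_thetaLambertTerm (hq : ‖q‖ < 1)
    (hζ : ζ = exp (2 * Real.pi * I * (1 / 6))) (hn : ‖ζ‖ = 1) (n : ℕ) :
    thetaLambertTerm ζ q n + thetaLambertTerm (ζ ^ 2) q n =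
      2 * (1 - 2 * ζ) * ((q ^ (n + 1) - (q ^ (n + 1)) ^ 5) / (1 - (q ^ (n + 1)) ^ 6)) := by
  have hr : ‖q ^ (n + 1)‖ < 1 := norm_pow_lt_one hq n.succ_ne_zero
  simp only [thetaLambertTerm]
  generalize q ^ (n + 1) = r at hr ⊢
  have hζ2 := exp_pi_div_three hζ
  have hne (x : ℂ) (hx : ‖x‖ = 1) : 1 - x * r ≠ 0 := by
    simpa using one_sub_mul_pow_ne_zero hr (x := x * r) (by rwa [norm_mul, hx, one_mul]) 0
  have hζi := inv_exp_pi_div_three hζ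
  have h1 := hne ζ hn
  have h2 := hne ζ⁻¹ (by rw [norm_inv, hn, inv_one])
  have h3 := hne (ζ ^ 2) (by rw [norm_pow, hn, one_pow])
  have h4 := hne (ζ ^ 2)⁻¹ (by rw [norm_inv, norm_pow, hn, one_pow, inv_one])
  have h6 : 1 - r ^ 6 ≠ 0 := by
    rw [pow_succ']
    exact one_sub_mul_pow_ne_zero hr hr 5
  rw [← inv_pow, hζi, show (1 - ζ) ^ 2 = -ζ by linear_combination hζ2] at h4 ⊢
  rw [hζi] at h2
  rw [hζ2] at h3 ⊢
  -- These denominators multiply to `1 + r ^ 2 + r ^ 4 = (1 - r ^ 6) / (1 - r ^ 2)`.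
  have d1 : (1 - (1 - ζ) * r) * (1 - ζ * r) = 1 - r + r ^ 2 := by
    linear_combination (-r ^ 2) * hζ2
  have d2 : (1 - -ζ * r) * (1 - (ζ - 1) * r) = 1 + r + r ^ 2 := by
    linear_combination (-r ^ 2) * hζ2
  have n1 := mul_ne_zero h2 h1
  have n2 := mul_ne_zero h4 h3
  rw [div_sub_div _ _ h2 h1, div_sub_div _ _ h4 h3]
  rw [d1] at n1 ⊢
  rw [d2] at n2 ⊢
  rw [div_add_div _ _ n1 n2, ← mul_div_assoc, div_eq_div_iff (mul_ne_zero n1 n2) h6]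
  ring

theorem eta_quotient_eq_lambert (hτ : 0 < τ.im) :
    ModularForm.eta (2 * τ) ^ 6 * ModularForm.eta (3 * τ) /
        (ModularForm.eta τ ^ 3 * ModularForm.eta (6 * τ) ^ 2) =
      1 + 3 * ∑' n : ℕ+, ((divisorCountMod 1 6 n : ℂ) - divisorCountMod 5 6 n) *
        exp (2 * Real.pi * I * τ) ^ (n : ℕ) := by
  obtain ⟨q, hq⟩ : ∃ q, q = exp (2 * Real.pi * I * τ) := ⟨_, rfl⟩
  obtain ⟨ζ, hζ⟩ : ∃ ζ, ζ = exp (2 * Real.pi * I * (1 / 6)) := ⟨_, rfl⟩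
  have hq1 : ‖q‖ < 1 := hq ▸ norm_exp_two_pi_mul_I_lt_one hτ
  have hζ2 := exp_pi_div_three hζ
  have hω : ζ ^ 2 = exp (2 * Real.pi * I * (1 / 3)) := by
    rw [hζ, ← Complex.exp_nat_mul]; congr 1; push_cast; ring
  have hζ6 : ζ ^ 6 = 1 := by
    linear_combination (ζ ^ 4 + ζ ^ 3 - ζ - 1) * hζ2
  have hn : ‖ζ‖ = 1 := norm_eq_one_of_pow_eq_one hζ6 (by norm_num)
  have hζ1 : ζ ≠ 1 := by rintro rfl; norm_num at hζ2
  have hω1 : ζ ^ 2 ≠ 1 := by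
    intro h
    have h' : ζ = 2 := by linear_combination h - hζ2
    norm_num [h'] at h
  have d1 := hasDerivAt_jacobiTheta₂_half_period_add (1 / 6) hτ hq hζ hζ1 hn
  have d2 := hasDerivAt_jacobiTheta₂_half_period_add (1 / 3) hτ hq hω hω1 (by simp [hn])
  have hE : HasDerivAt (fun x : ℂ ↦ exp (2 * Real.pi * I * x)) (2 * Real.pi * I) 0 := by
    simpa using ((hasDerivAt_id (0 : ℂ)).const_mul (2 * Real.pi * I)).cexp
  have hd := (hasDerivAt_exp_mul_jacobiTheta₂_mul_jacobiTheta₂ hτ hq).unique (hE.mul (d1.mul d2))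
  have hΛ := hasSum_lambert_charModSix hq1
  have hs := (summable_thetaLambertTerm hq1 ζ).tsum_add (summable_thetaLambertTerm hq1 (ζ ^ 2))
  simp only [thetaLambertTerm_add_thetaLambertTerm hq1 hζ hn, tsum_mul_left, hΛ.tsum_eq] at hs
  -- The leading `1` comes from differentiating the exponential twist. Against the Lambert
  -- coefficient `2 * (1 - 2 * ζ)` this constant gives `1 + 3 * Λ`.
  have hc : 1 + 1 / (ζ - 1) + 1 / (ζ ^ 2 - 1) = 2 / 3 * (1 - 2 * ζ) := by
    have e1 : 1 / (ζ - 1) = -ζ := by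
      rw [div_eq_iff (sub_ne_zero.mpr hζ1)]
      linear_combination hζ2
    have e2 : 1 / (ζ ^ 2 - 1) = -(ζ + 1) / 3 := by
      rw [div_eq_iff (sub_ne_zero.mpr hω1)]
      linear_combination (ζ + 2) / 3 * hζ2
    rw [e1, e2]
    ring
  have hT := jacobiTheta₂_one_sixth hτ hq hζ
  have hH := jacobiTheta₂_mul_half_period_add hτ hq hζ
  simp only [add_zero, mul_zero, exp_zero, one_mul] at hd
  have he (k : ℕ) (hk : k ≠ 0) : qProd (q ^ k) (q ^ k) ≠ 0 :=
    qProd_ne_zero_of_norm_lt_one (norm_pow_lt_one hq1 hk) (norm_pow_lt_one hq1 hk)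
  have he1 : qProd q q ≠ 0 := by simpa using he 1 one_ne_zero
  have he6 := he 6 (by norm_num)
  have hqk (k : ℕ) : exp (2 * Real.pi * I * (k * τ)) = q ^ k := by
    rw [hq, ← Complex.exp_nat_mul]; congr 1; ring
  have hv (k : ℕ) : exp (2 * Real.pi * I * (k * τ) / 24) = exp (2 * Real.pi * I * τ / 24) ^ k := by
    rw [← Complex.exp_nat_mul]; congr 1; ring
  have hk2 := hqk 2
  have hk3 := hqk 3
  have hk6 := hqk 6
  have hv2 := hv 2
  have hv3 := hv 3
  have hv6 := hv 6
  push_cast at hk2 hk3 hk6 hv2 hv3 hv6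
  rw [eta_eq_exp_mul_qProd (2 * τ), eta_eq_exp_mul_qProd (3 * τ), eta_eq_exp_mul_qProd τ,
    eta_eq_exp_mul_qProd (6 * τ), hk2, hk3, hk6, hv2, hv3, hv6, ← hq]
  have hv0 := exp_ne_zero (2 * Real.pi * I * τ / 24)
  generalize exp (2 * Real.pi * I * τ / 24) = v at hv0 ⊢
  generalize ∑' n : ℕ+, ((divisorCountMod 1 6 n : ℂ) - divisorCountMod 5 6 n) *
    q ^ (n : ℕ) = Λ at hs ⊢
  have hd2 : 2 * qProd (q ^ 2) (q ^ 2) ^ 3 * jacobiTheta₂ (1 / 6) (2 * τ) =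
      jacobiTheta₂ (1 / 6 + τ / 2 + 1 / 2) τ * jacobiTheta₂ (1 / 3 + τ / 2 + 1 / 2) τ *
      (2 / 3 * (1 - 2 * ζ) * (1 + 3 * Λ)) := by
    have hpi : (2 * Real.pi * I : ℂ) ≠ 0 := two_pi_I_ne_zero
    refine mul_left_cancel₀ hpi ?_
    linear_combination hd + (jacobiTheta₂ (1 / 6 + τ / 2 + 1 / 2) τ *
      jacobiTheta₂ (1 / 3 + τ / 2 + 1 / 2) τ * (2 * Real.pi * I)) * (hc - hs)
  have hfin : qProd (q ^ 2) (q ^ 2) ^ 6 * qProd (q ^ 3) (q ^ 3) =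
      qProd q q ^ 3 * qProd (q ^ 6) (q ^ 6) ^ 2 * (1 + 3 * Λ) := by
    generalize qProd (q ^ 2) (q ^ 2) = e2 at *
    generalize qProd (q ^ 3) (q ^ 3) = e3 at *
    generalize qProd (q ^ 6) (q ^ 6) = e6 at *
    generalize qProd q q = e1 at *
    linear_combination (-e2 ^ 4) * hT + e1 * e6 * e2 / 2 * hd2 +
      (1 / 3 * (1 - 2 * ζ) * (1 + 3 * Λ)) * e1 * e6 * hH -
      4 / 3 * e1 ^ 3 * e6 ^ 2 * (1 + 3 * Λ) * hζ2
  rw [div_eq_iff (mul_ne_zero (pow_ne_zero _ (mul_ne_zero hv0 he1))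
    (pow_ne_zero _ (mul_ne_zero (pow_ne_zero _ hv0) he6)))]
  -- Numerator and denominator both carry `v ^ 15`: `2 * 6 + 3 = 3 + 6 * 2`.
  linear_combination v ^ 15 * hfin

end WeightOne

theorem mainTheorem8 (τ : UpperHalfPlane) :
    HasSum
      (fun n : ℕ+ => (-1 : ℂ) ^ ((n : ℕ) - 1) * ((n : ℕ) : ℂ) *
        ((legendreSym 3 ((n : ℕ) : ℤ) : ℤ) : ℂ) *
        Complex.exp (2 * Real.pi * Complex.I * ((n : ℕ) : ℂ) ^ 2 * (τ : ℂ) / 3))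
      (ModularForm.eta (2 * (τ : ℂ)) ^ 5 / ModularForm.eta (τ : ℂ) ^ 2) ∧
    Summable
      (fun n : ℕ+ => ((divisorCountMod 1 6 n : ℂ) - (divisorCountMod 5 6 n : ℂ)) *
        Complex.exp (2 * Real.pi * Complex.I * (τ : ℂ)) ^ (n : ℕ)) ∧
    ModularForm.eta (2 * (τ : ℂ)) ^ 6 * ModularForm.eta (3 * (τ : ℂ)) /
        (ModularForm.eta (τ : ℂ) ^ 3 * ModularForm.eta (6 * (τ : ℂ)) ^ 2) =
      1 + 3 * ∑' n : ℕ+, ((divisorCountMod 1 6 n : ℂ) - (divisorCountMod 5 6 n : ℂ)) *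
        Complex.exp (2 * Real.pi * Complex.I * (τ : ℂ)) ^ (n : ℕ) := by
  exact ⟨hasSum_koehler_macdonald τ.im_pos,
    (hasSum_divisorCountMod (norm_exp_two_pi_mul_I_lt_one τ.im_pos)).summable,
    eta_quotient_eq_lambert τ.im_pos⟩
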